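/- Let $d\ge 1$, let $\Omega\subset\mathbb R^d$ be open, bounded and convex, and let $\mathcal P_a(\Omega)$ be the set of measurable $\rho:\Omega\to[0,\infty)$ with $\int_\Omega\rho\,dx=1$. For $c:\mathbb R^d\to[0,\infty)$, $h>0$ and $\rho,\tilde\rho\in\mathcal P_a(\Omega)$ let $\Gamma(\rho,\tilde\rho)$ be the set of Borel probability measures on $\mathbb R^d\times\mathbb R^d$ with marginals $\rho\,dx$ and $\tilde\rho\,dx$, and put $$W_c^h(\rho,\tilde\rho)=\inf_{\gamma\in\Gamma(\rho,\tilde\rho)}\int c\Big(\frac{x-y}{h}\Big)\,d\gamma(x,y);$$ a minimizing $\gamma$ is called $c_h$-optimal. For $F:[0,\infty)\to\mathbb R$ put $E_i(\rho)=\int_\Omega F(\rho(x))\,dx\in(-\infty,+\infty]$. Given $\rho_0\in\mathcal P_a(\Omega)$, the discrete scheme with time step $h$ is $\rho_0^h=\rho_0$ and, for $i\ge1$, $\rho_i^h$ a minimizer over $\rho\in\mathcal P_a(\Omega)$ of $$h\,W_c^h(\rho_{i-1}^h,\rho)+E_i(\rho),$$ and $\gamma_i^h$ denotes a $c_h$-optimal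 measure in $\Gamma(\rho_{i-1}^h,\rho_i^h)$. **Proposition.** Let $F:[0,\infty)\to\mathbb R$ be strictly convex, let $\rho_0\in\mathcal P_a(\Omega)$ be bounded above and bounded away from $0$ almost everywhere on $\Omega$, and let $T>0$, $q>1$, $\beta>0$. There is a constant $M=M(\Omega,T,F,\rho_0,q,\beta)$ such that for every strictly convex $c:\mathbb R^d\to[0,\infty)$ with $c(0)=0$ and $c(z)\ge\beta|z|^q$ for all $z\in\mathbb R^d$, and every $h\in(0,1)$ with $T/h\in\mathbb N$, $$\sum_{i=1}^{T/h}\int|x-y|^2\,d\gamma_i^h(x,y)\;\le\;M\,h^{\epsilon(q)},\qquad \epsilon(q)=\min(1,q-1).$$ Consequently, for every such $c$, this sum tends to $0$ as $h\to0$ through values in $(0,1)$ with $T/h\in\mathbb N$. -/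

import Mathlib

open MeasureTheory Filter Topology
open scoped ENNReal

namespace SteepestDescent

noncomputable section

/-- Probability densities on `Ω`: measurable `ρ : Ω → [0,∞)` with `∫_Ω ρ = 1`. A function on `Ω` is
represented by a function on the whole space; its values outside `Ω` play no role. -/
structure IsDensity {d : ℕ} (Ω : Set (EuclideanSpace ℝ (Fin d)))
    (ρ : EuclideanSpace ℝ (Fin d) → ℝ) : Prop where
  measurable : Measurable (Ω.domRestrict ρ)
  nonneg : ∀ x ∈ Ω, 0 ≤ ρ x
  mass : ∫⁻ x in Ω, ENNReal.ofReal (ρ x) = 1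

/-- The Borel measure `ρ(x) dx` carried by `Ω`. -/
def densityMeasure {d : ℕ} (Ω : Set (EuclideanSpace ℝ (Fin d)))
    (ρ : EuclideanSpace ℝ (Fin d) → ℝ) : Measure (EuclideanSpace ℝ (Fin d)) :=
  (volume.restrict Ω).withDensity fun x => ENNReal.ofReal (ρ x)

/-- `Γ(μ₀, μ₁)`: the Borel probability measures on the product with marginals `μ₀` and `μ₁`. -/
def couplings {d : ℕ} (μ₀ μ₁ : Measure (EuclideanSpace ℝ (Fin d))) :
    Set (Measure (EuclideanSpace ℝ (Fin d) × EuclideanSpace ℝ (Fin d))) :=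
  {γ | IsProbabilityMeasure γ ∧ γ.map Prod.fst = μ₀ ∧ γ.map Prod.snd = μ₁}

/-- The work `∫ c((x - y)/h) dγ(x,y)` of a transport plan, for a cost `c ≥ 0`. -/
def transportCost {d : ℕ} (c : EuclideanSpace ℝ (Fin d) → ℝ) (h : ℝ)
    (γ : Measure (EuclideanSpace ℝ (Fin d) × EuclideanSpace ℝ (Fin d))) : ℝ≥0∞ :=
  ∫⁻ p, ENNReal.ofReal (c (h⁻¹ • (p.1 - p.2))) ∂γ

/-- The Monge-Kantorovich work `W_c^h(ρ₀, ρ₁)`. -/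
def work {d : ℕ} (Ω : Set (EuclideanSpace ℝ (Fin d))) (c : EuclideanSpace ℝ (Fin d) → ℝ) (h : ℝ)
    (ρ₀ ρ₁ : EuclideanSpace ℝ (Fin d) → ℝ) : ℝ≥0∞ :=
  ⨅ γ ∈ couplings (densityMeasure Ω ρ₀) (densityMeasure Ω ρ₁), transportCost c h γ

/-- `γ` is a `c_h`-optimal measure in `Γ(ρ₀, ρ₁)`, where `c_h(z) = c(z/h)`. -/
def IsOptimalPlan {d : ℕ} (Ω : Set (EuclideanSpace ℝ (Fin d)))
    (c : EuclideanSpace ℝ (Fin d) → ℝ) (h : ℝ) (ρ₀ ρ₁ : EuclideanSpace ℝ (Fin d) → ℝ)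
    (γ : Measure (EuclideanSpace ℝ (Fin d) × EuclideanSpace ℝ (Fin d))) : Prop :=
  γ ∈ couplings (densityMeasure Ω ρ₀) (densityMeasure Ω ρ₁) ∧
    ∀ γ' ∈ couplings (densityMeasure Ω ρ₀) (densityMeasure Ω ρ₁),
      transportCost c h γ ≤ transportCost c h γ'

open Classical in
/-- The internal energy `∫_Ω F(ρ(x)) dx ∈ (-∞, +∞]`. For a convex `F`, a bounded `Ω` and a density
`ρ`, the negative part of `F ∘ ρ` is integrable over `Ω` (`F` lies above an affine function), so a
failure of integrability means that the integral is `+∞`. -/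
def internalEnergy {d : ℕ} (Ω : Set (EuclideanSpace ℝ (Fin d))) (F : ℝ → ℝ)
    (ρ : EuclideanSpace ℝ (Fin d) → ℝ) : EReal :=
  if IntegrableOn (fun x => F (ρ x)) Ω then ((∫ x in Ω, F (ρ x) : ℝ) : EReal) else ⊤

/-- The functional `ρ ↦ h W_c^h(ρ₀, ρ) + E_i(ρ)`. -/
def stepFunctional {d : ℕ} (Ω : Set (EuclideanSpace ℝ (Fin d))) (F : ℝ → ℝ)
    (c : EuclideanSpace ℝ (Fin d) → ℝ) (h : ℝ) (ρ₀ ρ : EuclideanSpace ℝ (Fin d) → ℝ) : EReal :=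
  ((ENNReal.ofReal h * work Ω c h ρ₀ ρ : ℝ≥0∞) : EReal) + internalEnergy Ω F ρ

/-- `ρ₁` minimizes `ρ ↦ h W_c^h(ρ₀, ρ) + E_i(ρ)` over all probability densities on `Ω`. -/
def IsStepMinimizer {d : ℕ} (Ω : Set (EuclideanSpace ℝ (Fin d))) (F : ℝ → ℝ)
    (c : EuclideanSpace ℝ (Fin d) → ℝ) (h : ℝ) (ρ₀ ρ₁ : EuclideanSpace ℝ (Fin d) → ℝ) : Prop :=
  IsDensity Ω ρ₁ ∧
    ∀ ρ, IsDensity Ω ρ → stepFunctional Ω F c h ρ₀ ρ₁ ≤ stepFunctional Ω F c h ρ₀ ρ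

/-- The discrete scheme with time step `h` started at `ρ₀`: `ρ i` is the `i`-th iterate and, for
`i ≥ 1`, `γ i` is the `c_h`-optimal measure between the iterates `i - 1` and `i` (`γ 0` plays no
role). -/
structure IsDiscreteScheme {d : ℕ} (Ω : Set (EuclideanSpace ℝ (Fin d))) (F : ℝ → ℝ)
    (c : EuclideanSpace ℝ (Fin d) → ℝ) (ρ₀ : EuclideanSpace ℝ (Fin d) → ℝ) (h : ℝ)
    (ρ : ℕ → EuclideanSpace ℝ (Fin d) → ℝ)
    (γ : ℕ → Measure (EuclideanSpace ℝ (Fin d) × EuclideanSpace ℝ (Fin d))) : Prop where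
  init : ρ 0 = ρ₀
  step : ∀ i : ℕ, IsStepMinimizer Ω F c h (ρ i) (ρ (i + 1))
  plan : ∀ i : ℕ, IsOptimalPlan Ω c h (ρ i) (ρ (i + 1)) (γ (i + 1))

/-- `∫ |x - y|² dγ(x,y)`, as an element of `[0, ∞]`. -/
def secondMoment {d : ℕ}
    (γ : Measure (EuclideanSpace ℝ (Fin d) × EuclideanSpace ℝ (Fin d))) : ℝ≥0∞ :=
  ∫⁻ p, ENNReal.ofReal (‖p.1 - p.2‖ ^ 2) ∂γ

end

end SteepestDescent

namespace SteepestDescent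

variable {d : ℕ} {Ω : Set (EuclideanSpace ℝ (Fin d))} {F : ℝ → ℝ}
  {c : EuclideanSpace ℝ (Fin d) → ℝ} {h : ℝ} {ρ₀ ρ₁ : EuclideanSpace ℝ (Fin d) → ℝ}
  {γ : Measure (EuclideanSpace ℝ (Fin d) × EuclideanSpace ℝ (Fin d))}

/-- A convex function on `[0, ∞)` has a supporting line at `1`. -/
theorem exists_supporting_line (hF : ConvexOn ℝ (Set.Ici 0) F) :
    ∃ m : ℝ, ∀ t, 0 ≤ t → F 1 + m * (t - 1) ≤ F t := by
  have hmem : (1 : ℝ) ∈ interior (Set.Ici (0 : ℝ)) := by simp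
  -- The slope is the right derivative at 1; an interior point is needed, since the slope at 0 may
  -- be -∞.
  refine ⟨derivWithin F (Set.Ioi 1) 1, fun t ht => ?_⟩
  rcases lt_trichotomy t 1 with h1 | rfl | h1
  · have h2 := (hF.slope_le_leftDeriv_of_mem_interior (x := t) ht hmem h1).trans
      (hF.leftDeriv_le_rightDeriv_of_mem_interior hmem)
    rw [slope_def_field, div_le_iff₀ (by linarith)] at h2
    linarith
  · simp
  · have h2 := hF.rightDeriv_le_slope_of_mem_interior hmem (y := t) ht h1
    rw [slope_def_field, le_div_iff₀ (by linarith)] at h2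
    linarith

theorem IsDensity.aemeasurable (hΩ : MeasurableSet Ω) (h₀ : IsDensity Ω ρ₀) :
    AEMeasurable ρ₀ (volume.restrict Ω) :=
  aemeasurable_restrict_of_measurable_subtype hΩ h₀.measurable

theorem IsDensity.ae_nonneg (hΩ : MeasurableSet Ω) (h₀ : IsDensity Ω ρ₀) :
    0 ≤ᵐ[volume.restrict Ω] ρ₀ := by
  filter_upwards [ae_restrict_mem hΩ] with x hx using h₀.nonneg x hx

theorem IsDensity.integrableOn (hΩ : MeasurableSet Ω) (h₀ : IsDensity Ω ρ₀) :
    IntegrableOn ρ₀ Ω := by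
  refine ⟨(h₀.aemeasurable hΩ).aestronglyMeasurable, ?_⟩
  rw [hasFiniteIntegral_iff_ofReal (h₀.ae_nonneg hΩ), h₀.mass]
  exact ENNReal.one_lt_top

theorem IsDensity.integral_eq_one (hΩ : MeasurableSet Ω) (h₀ : IsDensity Ω ρ₀) :
    ∫ x in Ω, ρ₀ x = 1 := by
  rw [integral_eq_lintegral_of_nonneg_ae (h₀.ae_nonneg hΩ)
    (h₀.aemeasurable hΩ).aestronglyMeasurable, h₀.mass, ENNReal.toReal_one]

/-- The internal energy of probability densities is bounded below. -/
theorem exists_le_internalEnergy (hΩ : MeasurableSet Ω) (hfin : volume Ω ≠ ∞)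
    (hF : ConvexOn ℝ (Set.Ici 0) F) :
    ∃ K : ℝ, ∀ ρ, IsDensity Ω ρ → (K : EReal) ≤ internalEnergy Ω F ρ := by
  obtain ⟨m, hm⟩ := exists_supporting_line hF
  -- This is the integral of the supporting line along ρ; unit mass makes it independent of ρ.
  refine ⟨(F 1 - m) * volume.real Ω + m, fun ρ hρ => ?_⟩
  unfold internalEnergy
  split_ifs with hint
  · rw [EReal.coe_le_coe_iff]
    have hconst : IntegrableOn (fun _ : EuclideanSpace ℝ (Fin d) => F 1 - m) Ω :=
      integrableOn_const hfin
    have hlin := (hρ.integrableOn hΩ).const_mul m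
    calc (F 1 - m) * volume.real Ω + m = ∫ x in Ω, ((F 1 - m) + m * ρ x) := by
          rw [integral_add hconst hlin, integral_const_mul, hρ.integral_eq_one hΩ]
          simp [mul_comm]
      _ ≤ ∫ x in Ω, F (ρ x) := by
          refine setIntegral_mono_on (hconst.add hlin) hint hΩ fun x hx => ?_
          have := hm (ρ x) (hρ.nonneg x hx)
          linarith
  · exact le_top

/-- The internal energy of a density with values in a compact part of `(0, ∞)` is finite. -/
theorem internalEnergy_ne_top (hΩ : MeasurableSet Ω) (hfin : volume Ω ≠ ∞)
    (hF : ConvexOn ℝ (Set.Ici 0) F) (h₀ : IsDensity Ω ρ₀) {a b : ℝ} (ha : 0 < a)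
    (hab : ∀ᵐ x ∂(volume.restrict Ω), a ≤ ρ₀ x ∧ ρ₀ x ≤ b) :
    internalEnergy Ω F ρ₀ ≠ ⊤ := by
  -- F may jump at 0, hence the need for a > 0.
  have hcont : ContinuousOn F (Set.Icc a b) := by
    have := hF.continuousOn_interior
    rw [interior_Ici] at this
    exact this.mono fun x hx => ha.trans_le hx.1
  -- F is arbitrary on the negative axis, so measurability is claimed only after truncation to [a,
  -- b].
  have hmeas : Measurable ((Set.Icc a b).indicator F) := by
    classical
    rw [← Set.piecewise_eq_indicator]
    exact hcont.measurable_piecewise continuousOn_const measurableSet_Icc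
  obtain ⟨B, hB⟩ := isCompact_Icc.exists_bound_of_continuousOn hcont
  have hint : IntegrableOn (fun x => F (ρ₀ x)) Ω := by
    refine IntegrableOn.of_bound hfin.lt_top ?_ B ?_
    · refine (((hmeas.comp_aemeasurable (h₀.aemeasurable hΩ))).congr ?_).aestronglyMeasurable
      filter_upwards [hab] with x hx
      simp [Set.indicator_of_mem (show ρ₀ x ∈ Set.Icc a b from hx)]
    · filter_upwards [hab] with x hx using hB _ hx
  simp [internalEnergy, hint]

/-! ### Energy decay along the scheme -/

/-- A density is at distance zero from itself: use the diagonal plan. -/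
theorem work_self (hc : c 0 = 0) (h₀ : IsDensity Ω ρ₀) : work Ω c h ρ₀ ρ₀ = 0 := by
  have hdiag : Measurable fun x : EuclideanSpace ℝ (Fin d) => (x, x) :=
    measurable_id.prodMk measurable_id
  have : IsProbabilityMeasure (densityMeasure Ω ρ₀) := ⟨by
    rw [densityMeasure, withDensity_apply _ MeasurableSet.univ, Measure.restrict_univ, h₀.mass]⟩
  have hmem : (densityMeasure Ω ρ₀).map (fun x => (x, x)) ∈
      couplings (densityMeasure Ω ρ₀) (densityMeasure Ω ρ₀) := by
    refine ⟨Measure.isProbabilityMeasure_map hdiag.aemeasurable, ?_, ?_⟩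
    · rw [Measure.map_map measurable_fst hdiag]
      exact Measure.map_id
    · rw [Measure.map_map measurable_snd hdiag]
      exact Measure.map_id
  refine le_antisymm ((iInf₂_le _ hmem).trans ?_) zero_le
  -- This inequality requires no measurability of c.
  refine (lintegral_map_le _ _).trans ?_
  simp [hc]

theorem IsOptimalPlan.work_eq (hγ : IsOptimalPlan Ω c h ρ₀ ρ₁ γ) :
    work Ω c h ρ₀ ρ₁ = transportCost c h γ :=
  le_antisymm (iInf₂_le _ hγ.1) (le_iInf₂ hγ.2)

/-- One step of the scheme: the work is paid for by a decrease of the energy. -/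
theorem IsStepMinimizer.energy_le (hc : c 0 = 0) (h₀ : IsDensity Ω ρ₀)
    (hmin : IsStepMinimizer Ω F c h ρ₀ ρ₁) (hγ : IsOptimalPlan Ω c h ρ₀ ρ₁ γ) :
    ((ENNReal.ofReal h * transportCost c h γ : ℝ≥0∞) : EReal) + internalEnergy Ω F ρ₁ ≤
      internalEnergy Ω F ρ₀ := by
  have := hmin.2 ρ₀ h₀
  simpa only [stepFunctional, work_self hc h₀, hγ.work_eq, mul_zero, EReal.coe_ennreal_zero,
    zero_add] using this

theorem IsDiscreteScheme.isDensity {ρ : ℕ → EuclideanSpace ℝ (Fin d) → ℝ}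
    {γ : ℕ → Measure (EuclideanSpace ℝ (Fin d) × EuclideanSpace ℝ (Fin d))}
    (hs : IsDiscreteScheme Ω F c ρ₀ h ρ γ) (h₀ : IsDensity Ω ρ₀) (i : ℕ) :
    IsDensity Ω (ρ i) := by
  cases i with
  | zero => rw [hs.init]; exact h₀
  | succ i => exact (hs.step i).1

/-- The energy inequality of the discrete scheme. -/
theorem IsDiscreteScheme.energy_le {ρ : ℕ → EuclideanSpace ℝ (Fin d) → ℝ}
    {γ : ℕ → Measure (EuclideanSpace ℝ (Fin d) × EuclideanSpace ℝ (Fin d))}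
    (hs : IsDiscreteScheme Ω F c ρ₀ h ρ γ) (hc : c 0 = 0) (h₀ : IsDensity Ω ρ₀) (n : ℕ) :
    ((ENNReal.ofReal h * ∑ i ∈ Finset.Icc 1 n, transportCost c h (γ i) : ℝ≥0∞) : EReal) +
      internalEnergy Ω F (ρ n) ≤ internalEnergy Ω F ρ₀ := by
  induction n with
  | zero => simp [hs.init]
  | succ n ih =>
    rw [Finset.sum_Icc_succ_top (by omega), mul_add, EReal.coe_ennreal_add, add_assoc]
    exact (add_le_add_right
      ((hs.step n).energy_le hc (hs.isDensity h₀ n) (hs.plan n)) _).trans ih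

/-- The total transport cost of the scheme is at most the energy gap. -/
theorem IsDiscreteScheme.sum_transportCost_le {ρ : ℕ → EuclideanSpace ℝ (Fin d) → ℝ}
    {γ : ℕ → Measure (EuclideanSpace ℝ (Fin d) × EuclideanSpace ℝ (Fin d))}
    (hs : IsDiscreteScheme Ω F c ρ₀ h ρ γ) (hc : c 0 = 0) (h₀ : IsDensity Ω ρ₀) {K L : ℝ}
    (hK : ∀ ρ, IsDensity Ω ρ → (K : EReal) ≤ internalEnergy Ω F ρ)
    (hL : internalEnergy Ω F ρ₀ ≤ L) (n : ℕ) :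
    ENNReal.ofReal h * ∑ i ∈ Finset.Icc 1 n, transportCost c h (γ i) ≤
      ENNReal.ofReal (L - K) := by
  have key := (add_le_add_right (hK _ (hs.isDensity h₀ n)) _).trans
    ((hs.energy_le hc h₀ n).trans hL)
  generalize ENNReal.ofReal h * ∑ i ∈ Finset.Icc 1 n, transportCost c h (γ i) = x at key ⊢
  induction x with
  -- An infinite total cost would contradict the finite bound L, as K is real.
  | top => simp at key
  | coe x =>
    have hx : (x : ℝ) + K ≤ L := EReal.coe_le_coe_iff.1 key
    rw [ENNReal.le_ofReal_iff_toReal_le ENNReal.coe_ne_top (by linarith [x.coe_nonneg])]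
    simpa using by linarith

/-! ### From transport cost to second moment -/

/-- If q ≤ 2, the powers of h cancel and s² = s^(2-q) s^q with s^(2-q) ≤ D, because 2 - q ≤ 1 ≤ D.
If q ≥ 2, use t² ≤ 1 + t^q at t = s/h; the 1 produces the term h². -/
theorem sq_le_add_rpow {q s h D : ℝ} (hq : 1 < q) (hs : 0 ≤ s) (hsD : s ≤ D) (hD : 1 ≤ D)
    (hh : 0 < h) : s ^ 2 ≤ h ^ 2 + D * h ^ min 2 q * (s / h) ^ q := by
  have hsh : 0 ≤ s / h := by positivity
  rcases le_total q 2 with hq2 | hq2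
  · rw [min_eq_right hq2, mul_assoc, ← Real.mul_rpow hh.le hsh, mul_div_cancel₀ _ hh.ne']
    rcases hs.eq_or_lt with rfl | hs
    · rw [Real.zero_rpow (by linarith)]
      nlinarith
    · have h1 : s ^ 2 = s ^ (2 - q) * s ^ q := by
        rw [← Real.rpow_add hs, ← Real.rpow_natCast]
        norm_num
      have h2 : s ^ (2 - q) ≤ D := calc
        s ^ (2 - q) ≤ D ^ (2 - q) := Real.rpow_le_rpow hs.le hsD (by linarith)
        _ ≤ D ^ (1 : ℝ) := Real.rpow_le_rpow_of_exponent_le hD (by linarith)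
        _ = D := Real.rpow_one D
      rw [h1]
      have := mul_le_mul_of_nonneg_right h2 (Real.rpow_nonneg hs.le q)
      nlinarith [sq_nonneg h]
  · rw [min_eq_left hq2, Real.rpow_two]
    have h1 : (s / h) ^ 2 ≤ 1 + (s / h) ^ q := by
      rcases le_total (s / h) 1 with h1 | h1
      · have := Real.rpow_nonneg hsh q
        nlinarith
      · have := Real.rpow_le_rpow_of_exponent_le h1 hq2
        rw [Real.rpow_two] at this
        linarith
    have h2 : s ^ 2 = h ^ 2 * (s / h) ^ 2 := by field_simp
    have h3 : h ^ 2 * (s / h) ^ q ≤ D * (h ^ 2 * (s / h) ^ q) :=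
      le_mul_of_one_le_left (by positivity) hD
    nlinarith [mul_le_mul_of_nonneg_left h1 (sq_nonneg h)]

theorem ae_mem_of_mem_couplings (hΩ : MeasurableSet Ω)
    (hγ : γ ∈ couplings (densityMeasure Ω ρ₀) (densityMeasure Ω ρ₁)) :
    ∀ᵐ p ∂γ, p.1 ∈ Ω ∧ p.2 ∈ Ω := by
  have hmem : ∀ ρ, ∀ᵐ x ∂(densityMeasure Ω ρ), x ∈ Ω := fun ρ =>
    (withDensity_absolutelyContinuous _ _).ae_le (ae_restrict_mem hΩ)
  have h1 := hmem ρ₀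
  have h2 := hmem ρ₁
  rw [← hγ.2.1] at h1
  rw [← hγ.2.2] at h2
  exact (ae_of_ae_map measurable_fst.aemeasurable h1).and
    (ae_of_ae_map measurable_snd.aemeasurable h2)

theorem secondMoment_le (hΩ : MeasurableSet Ω) {q β D : ℝ} (hq : 1 < q) (hβ : 0 < β)
    (hD : 1 ≤ D) (hΩD : ∀ x ∈ Ω, ∀ y ∈ Ω, ‖x - y‖ ≤ D) (hh : 0 < h)
    (hc : ∀ z, β * ‖z‖ ^ q ≤ c z)
    (hγ : γ ∈ couplings (densityMeasure Ω ρ₀) (densityMeasure Ω ρ₁)) :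
    secondMoment γ ≤ ENNReal.ofReal (h ^ 2) +
      ENNReal.ofReal (D / β * h ^ min 2 q) * transportCost c h γ := by
  have := hγ.1
  have hB : 0 ≤ D / β * h ^ min 2 q := by positivity
  calc secondMoment γ ≤ ∫⁻ p, (ENNReal.ofReal (h ^ 2) + ENNReal.ofReal (D / β * h ^ min 2 q) *
        ENNReal.ofReal (c (h⁻¹ • (p.1 - p.2)))) ∂γ := by
        refine lintegral_mono_ae ?_
        filter_upwards [ae_mem_of_mem_couplings hΩ hγ] with p hp
        have hcp := hc (h⁻¹ • (p.1 - p.2))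
        have hc0 : 0 ≤ c (h⁻¹ • (p.1 - p.2)) := le_trans (by positivity) hcp
        rw [← ENNReal.ofReal_mul hB, ← ENNReal.ofReal_add (by positivity) (mul_nonneg hB hc0)]
        refine ENNReal.ofReal_le_ofReal
          ((sq_le_add_rpow hq (norm_nonneg _) (hΩD _ hp.1 _ hp.2) hD hh).trans ?_)
        rw [norm_smul, norm_inv, Real.norm_of_nonneg hh.le, inv_mul_eq_div] at hcp
        have h1 := mul_le_mul_of_nonneg_left hcp hB
        have h2 : D / β * h ^ min 2 q * (β * (‖p.1 - p.2‖ / h) ^ q) =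
            D * h ^ min 2 q * (‖p.1 - p.2‖ / h) ^ q := by field_simp
        linarith
    _ = _ := by
        -- The constant summand is measurable and the factor finite, so again c need not be
        -- measurable.
        rw [lintegral_add_left measurable_const, lintegral_const_mul' _ _ ENNReal.ofReal_ne_top]
        simp [transportCost]

/-- The total second moment of the transport plans of the scheme. -/
theorem IsDiscreteScheme.sum_secondMoment_le {ρ : ℕ → EuclideanSpace ℝ (Fin d) → ℝ}
    {γ : ℕ → Measure (EuclideanSpace ℝ (Fin d) × EuclideanSpace ℝ (Fin d))}
    (hs : IsDiscreteScheme Ω F c ρ₀ h ρ γ) (hΩ : MeasurableSet Ω) (h₀ : IsDensity Ω ρ₀)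
    {q β D K L T : ℝ} (hq : 1 < q) (hβ : 0 < β) (hD : 1 ≤ D)
    (hΩD : ∀ x ∈ Ω, ∀ y ∈ Ω, ‖x - y‖ ≤ D)
    (hK : ∀ ρ, IsDensity Ω ρ → (K : EReal) ≤ internalEnergy Ω F ρ)
    (hL : internalEnergy Ω F ρ₀ ≤ L) (hT : 0 < T) (hc0 : c 0 = 0)
    (hc : ∀ z, β * ‖z‖ ^ q ≤ c z) (hh : 0 < h) (hh1 : h < 1) {n : ℕ} (hn : T / h = n) :
    ∑ i ∈ Finset.Icc 1 n, secondMoment (γ i) ≤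
      ENNReal.ofReal ((T + D / β * (L - K)) * h ^ min 1 (q - 1)) := by
  have hKL : 0 ≤ L - K := by
    have : (K : EReal) ≤ L := (hK _ h₀).trans hL
    exact sub_nonneg.2 (by exact_mod_cast this)
  have hmin : min 2 q = min 1 (q - 1) + 1 := by rw [← min_add_add_right]; norm_num
  have hpow : h ^ min 2 q = h ^ min 1 (q - 1) * h := by
    rw [hmin, Real.rpow_add_one hh.ne']
  have hhε : h ≤ h ^ min 1 (q - 1) := by
    simpa using Real.rpow_le_rpow_of_exponent_ge hh hh1.le (min_le_left 1 (q - 1))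
  have hnh : (n : ℝ) * h ^ 2 = T * h := by rw [← hn]; field_simp
  have hplan : ∀ i ∈ Finset.Icc 1 n, secondMoment (γ i) ≤ ENNReal.ofReal (h ^ 2) +
      ENNReal.ofReal (D / β * h ^ min 2 q) * transportCost c h (γ i) := by
    intro i hi
    obtain ⟨j, rfl⟩ := Nat.exists_eq_succ_of_ne_zero
      (Nat.one_le_iff_ne_zero.1 (Finset.mem_Icc.1 hi).1)
    exact secondMoment_le hΩ hq hβ hD hΩD hh hc (hs.plan j).1
  calc ∑ i ∈ Finset.Icc 1 n, secondMoment (γ i)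
      ≤ ENNReal.ofReal (n * h ^ 2) + ENNReal.ofReal (D / β * h ^ min 1 (q - 1)) *
          (ENNReal.ofReal h * ∑ i ∈ Finset.Icc 1 n, transportCost c h (γ i)) := by
        -- One factor h is split off h^min(2,q) and attached to the sum of costs, to match the
        -- energy estimate.
        refine (Finset.sum_le_sum hplan).trans_eq ?_
        rw [Finset.sum_add_distrib, ← Finset.mul_sum, Finset.sum_const, Nat.card_Icc,
          Nat.add_sub_cancel, nsmul_eq_mul, ENNReal.ofReal_mul (Nat.cast_nonneg n),
          ENNReal.ofReal_natCast, ← mul_assoc (ENNReal.ofReal (D / β * h ^ min 1 (q - 1))),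
          ← ENNReal.ofReal_mul (by positivity), hpow, mul_assoc (D / β)]
    _ ≤ ENNReal.ofReal (n * h ^ 2) +
          ENNReal.ofReal (D / β * h ^ min 1 (q - 1)) * ENNReal.ofReal (L - K) := by
        gcongr
        exact hs.sum_transportCost_le hc0 h₀ hK hL n
    _ ≤ _ := by
        rw [← ENNReal.ofReal_mul (by positivity), ← ENNReal.ofReal_add (by positivity)
          (by positivity), hnh]
        refine ENNReal.ofReal_le_ofReal ?_
        nlinarith [mul_le_mul_of_nonneg_left hhε hT.le]

end SteepestDescent

/-! ### The constant and the limit -/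

theorem proposition3p2 {d : ℕ} (hd : 1 ≤ d)
    (Ω : Set (EuclideanSpace ℝ (Fin d))) (hΩ_open : IsOpen Ω) (hΩ_bdd : Bornology.IsBounded Ω)
    (hΩ_convex : Convex ℝ Ω)
    (F : ℝ → ℝ) (hF : StrictConvexOn ℝ (Set.Ici 0) F)
    (ρ₀ : EuclideanSpace ℝ (Fin d) → ℝ) (hρ₀ : SteepestDescent.IsDensity Ω ρ₀)
    (hρ₀_bdd : ∃ a b : ℝ, 0 < a ∧ ∀ᵐ x ∂(volume.restrict Ω), a ≤ ρ₀ x ∧ ρ₀ x ≤ b)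
    (T : ℝ) (hT : 0 < T) (q : ℝ) (hq : 1 < q) (β : ℝ) (hβ : 0 < β) :
    ∃ M : ℝ, ∀ c : EuclideanSpace ℝ (Fin d) → ℝ,
      (∀ z, 0 ≤ c z) → StrictConvexOn ℝ Set.univ c → c 0 = 0 → (∀ z, β * ‖z‖ ^ q ≤ c z) →
      (∀ (h : ℝ) (n : ℕ), 0 < h → h < 1 → T / h = n →
        ∀ (ρ : ℕ → EuclideanSpace ℝ (Fin d) → ℝ)
          (γ : ℕ → Measure (EuclideanSpace ℝ (Fin d) × EuclideanSpace ℝ (Fin d))),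
          SteepestDescent.IsDiscreteScheme Ω F c ρ₀ h ρ γ →
          ∑ i ∈ Finset.Icc 1 n, SteepestDescent.secondMoment (γ i) ≤
            ENNReal.ofReal (M * h ^ (min 1 (q - 1)))) ∧
      (∀ (h : ℕ → ℝ) (n : ℕ → ℕ), (∀ k, 0 < h k ∧ h k < 1 ∧ T / h k = n k) →
        Tendsto h atTop (𝓝 0) →
        ∀ (ρ : ℕ → ℕ → EuclideanSpace ℝ (Fin d) → ℝ)
          (γ : ℕ → ℕ → Measure (EuclideanSpace ℝ (Fin d) × EuclideanSpace ℝ (Fin d))),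
          (∀ k, SteepestDescent.IsDiscreteScheme Ω F c ρ₀ (h k) (ρ k) (γ k)) →
          Tendsto (fun k => ∑ i ∈ Finset.Icc 1 (n k), SteepestDescent.secondMoment (γ k i))
            atTop (𝓝 0)) := by
  obtain ⟨a, b, ha, hab⟩ := hρ₀_bdd
  have hfin : volume Ω ≠ ∞ := hΩ_bdd.measure_lt_top.ne
  obtain ⟨K, hK⟩ :=
    SteepestDescent.exists_le_internalEnergy hΩ_open.measurableSet hfin hF.convexOn
  have hL : SteepestDescent.internalEnergy Ω F ρ₀ ≤
      ((SteepestDescent.internalEnergy Ω F ρ₀).toReal : EReal) :=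
    EReal.le_coe_toReal (SteepestDescent.internalEnergy_ne_top hΩ_open.measurableSet hfin
      hF.convexOn hρ₀ ha hab)
  have hΩD : ∀ x ∈ Ω, ∀ y ∈ Ω, ‖x - y‖ ≤ max 1 (Metric.diam Ω) := fun x hx y hy => by
    rw [← dist_eq_norm]
    exact (Metric.dist_le_diam_of_mem hΩ_bdd hx hy).trans (le_max_right _ _)
  -- The constant is fixed before c and involves c only through β; the maximum with 1 secures D ≥ 1.
  refine ⟨T + max 1 (Metric.diam Ω) / β *
    ((SteepestDescent.internalEnergy Ω F ρ₀).toReal - K), fun c _ _ hc0 hc => ?_⟩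
  have main := fun (h : ℝ) (n : ℕ) (hh : 0 < h) (hh1 : h < 1) (hn : T / h = n)
    (ρ : ℕ → EuclideanSpace ℝ (Fin d) → ℝ)
    (γ : ℕ → Measure (EuclideanSpace ℝ (Fin d) × EuclideanSpace ℝ (Fin d)))
    (hs : SteepestDescent.IsDiscreteScheme Ω F c ρ₀ h ρ γ) =>
    hs.sum_secondMoment_le hΩ_open.measurableSet hρ₀ hq hβ (le_max_left _ _) hΩD hK hL hT hc0 hc
      hh hh1 hn
  refine ⟨main, fun h n hhn hlim ρ γ hs => ?_⟩
  have hε : 0 < min 1 (q - 1) := lt_min one_pos (by linarith)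
  have hbound := ENNReal.tendsto_ofReal
    ((hlim.rpow_const (p := min 1 (q - 1)) (Or.inr hε.le)).const_mul
      (T + max 1 (Metric.diam Ω) / β * ((SteepestDescent.internalEnergy Ω F ρ₀).toReal - K)))
  rw [Real.zero_rpow hε.ne', mul_zero, ENNReal.ofReal_zero] at hbound
  exact tendsto_of_tendsto_of_tendsto_of_le_of_le tendsto_const_nhds hbound (fun _ => zero_le)
    fun k => main (h k) (n k) (hhn k).1 (hhn k).2.1 (hhn k).2.2 (ρ k) (γ k) (hs k)
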